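/- Let $X=\mathbb F_2[x]/(x^2)$, with standard derivation $\partial_x=d/dx$, and let $T(X)=\bigoplus_{n\ge 0}X^{\otimes n}$ be its tensor algebra over $\mathbb F_2$. Let $a,b,c,d$ be the $\mathbb F_2$-linear endomorphisms of $T(X)$ that vanish on $X^{\otimes 0}=\mathbb F_2$ and satisfy, for all $y\in X$ and $w\in T(X)$, \[ a(y\otimes w)=\partial_x y\otimes w,\quad b(y\otimes w)=xy\otimes (a+c)(w),\quad c(y\otimes w)=xy\otimes (a+d)(w),\quad d(y\otimes w)=xy\otimes b(w). \] In other words, they are the natural actions on $T(X)$ of generators with the self-similarity structure $a\mapsto\partial_x$, $b\mapsto x\otimes(a+c)$, $c\mapsto x\otimes(a+d)$, $d\mapsto x\otimes b$. Let ${}_2L_G$ be the restricted Grigorchuk Lie algebra: the restricted Lie subalgebra of $\operatorname{End}_{\mathbb F_2}(T(X))$ generated by $a,b,c,d$, that is, the least subspace that contains $a,b,c,d$ and is closed under the commutator bracket and under the $2$-mapping $u\mapsto u^2$. Theorem. 1. ${}_2L_G$ is nil: for every $u\in{}_2L_G$ there is $n$ such that the $n$-fold iterate $u^{2^n}$ of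 the $2$-mapping vanishes; and also $\operatorname{ad}(u)$ is a nilpotent endomorphism of ${}_2L_G$ for every $u$. 2. Its nillity is unbounded: for every $n$ there is $u\in{}_2L_G$ with $u^{2^n}\neq0$; and also for every $n$ there is $u\in{}_2L_G$ with $\operatorname{ad}(u)^n\neq0$. 3. ${}_2L_G$ is not a nilpotent Lie algebra. -/

import Mathlib

open scoped TensorProduct

namespace SelfSimilarLie

noncomputable section

section Recursion

variable {K X S : Type*} [CommRing K] [CommRing X] [Algebra K X]

/-- The data of a self-similarity structure on generators: `ψ s = (∑ yᵢ ⊗ sᵢ) + δ`, with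
`∑ yᵢ ⊗ sᵢ` in `X ⊗ K⟨S⟩` (`K⟨S⟩` being the free module on the generators) and
`δ` a derivation of `X`. -/
abbrev WreathRecursion (K X S : Type*) [CommRing K] [CommRing X] [Algebra K X] : Type _ :=
  S → (X ⊗[K] (S →₀ K)) × Derivation K X X

/-- Given a value `v s` (to be thought of as `s · w`) for every generator `s`, an element
`y₁ ⊗ s₁ + ⋯` of `X ⊗ K⟨S⟩` and a letter `x₁ : X`, this is
`x₁ y₁ ⊗ (s₁ · w) + ⋯` in the tensor algebra `T(X)`. -/
def tensorPart (x₁ : X) (t : X ⊗[K] (S →₀ K)) (v : S → TensorAlgebra K X) :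
    TensorAlgebra K X :=
  LinearMap.mul' K (TensorAlgebra K X)
    (TensorProduct.map (TensorAlgebra.ι K ∘ₗ LinearMap.mulLeft K x₁)
      (Finsupp.linearCombination K v) t)

/-- From the values `(s · w)` for all generators `s`, together with `w` itself, compute the
values `(s · (x₁ ⊗ w))`, together with `x₁ ⊗ w`, by the formula
`s · (x₁ ⊗ w) = ∑ x₁ yᵢ ⊗ (sᵢ · w) + δ x₁ ⊗ w` where `ψ s = ∑ yᵢ ⊗ sᵢ + δ`. -/
def step (ψ : WreathRecursion K X S) :
    X →ₗ[K] Module.End K ((S → TensorAlgebra K X) × TensorAlgebra K X) :=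
  LinearMap.mk₂ K
    (fun x₁ vw =>
      (fun s => tensorPart x₁ (ψ s).1 vw.1 + TensorAlgebra.ι K ((ψ s).2 x₁) * vw.2,
        TensorAlgebra.ι K x₁ * vw.2))
    (fun x y vw => by
      have h : TensorAlgebra.ι K ∘ₗ LinearMap.mulLeft K (x + y) =
          TensorAlgebra.ι K ∘ₗ LinearMap.mulLeft K x +
            TensorAlgebra.ι K ∘ₗ LinearMap.mulLeft K y := by
        ext z; simp [add_mul]
      refine Prod.ext (funext fun s => ?_) (by simp [add_mul])
      simp only [tensorPart, h, TensorProduct.map_add_left, LinearMap.add_apply, map_add,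
        Prod.fst_add, Pi.add_apply, add_mul]
      abel)
    (fun k x vw => by
      have h : TensorAlgebra.ι K ∘ₗ LinearMap.mulLeft K (k • x) =
          k • (TensorAlgebra.ι K ∘ₗ LinearMap.mulLeft K x) := by
        ext z; simp
      refine Prod.ext (funext fun s => ?_) (by simp)
      simp [tensorPart, h, TensorProduct.map_smul_left])
    (fun x vw vw' => by
      have h : Finsupp.linearCombination K (vw.1 + vw'.1) =
          Finsupp.linearCombination K vw.1 + Finsupp.linearCombination K vw'.1 := by
        ext s; simp
      refine Prod.ext (funext fun s => ?_) (by simp [mul_add])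
      simp only [tensorPart, h, TensorProduct.map_add_right, LinearMap.add_apply, map_add,
        Prod.fst_add, Prod.snd_add, Pi.add_apply, mul_add]
      abel)
    (fun k x vw => by
      have h : Finsupp.linearCombination K (k • vw.1) =
          k • Finsupp.linearCombination K vw.1 := by
        ext s; simp
      refine Prod.ext (funext fun s => ?_) (by simp)
      simp [tensorPart, h, TensorProduct.map_smul_right])

/-- The natural action of the generator `s` on the tensor algebra `T(X)`: the linear
endomorphism with `s · 1 = 0` and `s · (x₁ ⊗ w) = ∑ x₁ yᵢ ⊗ (sᵢ · w) + δ x₁ ⊗ w`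
whenever `ψ s = ∑ yᵢ ⊗ sᵢ + δ`; see `naturalAction_one` and `naturalAction_ι_mul`. -/
def naturalAction (ψ : WreathRecursion K X S) (s : S) : Module.End K (TensorAlgebra K X) :=
  LinearMap.proj s ∘ₗ LinearMap.fst K (S → TensorAlgebra K X) (TensorAlgebra K X) ∘ₗ
    LinearMap.applyₗ ((0, 1) : (S → TensorAlgebra K X) × TensorAlgebra K X) ∘ₗ
      (TensorAlgebra.lift K (step ψ)).toLinearMap

theorem naturalAction_apply (ψ : WreathRecursion K X S) (s : S) (w : TensorAlgebra K X) :
    naturalAction ψ s w = (TensorAlgebra.lift K (step ψ) w (0, 1)).1 s := rfl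

theorem lift_step_snd (ψ : WreathRecursion K X S) (w : TensorAlgebra K X)
    (v : (S → TensorAlgebra K X) × TensorAlgebra K X) :
    (TensorAlgebra.lift K (step ψ) w v).2 = w * v.2 := by
  induction w using TensorAlgebra.induction generalizing v with
  | algebraMap r => simp [Module.algebraMap_end_apply, Algebra.smul_def]
  | ι x => simp [step]
  | mul a b ha hb => simp [ha, hb, mul_assoc]
  | add a b ha hb => simp [ha, hb, add_mul]

theorem naturalAction_one (ψ : WreathRecursion K X S) (s : S) :
    naturalAction ψ s 1 = 0 := by
  simp [naturalAction_apply]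

theorem naturalAction_ι_mul (ψ : WreathRecursion K X S) (s : S) (x₁ : X)
    (w : TensorAlgebra K X) :
    naturalAction ψ s (TensorAlgebra.ι K x₁ * w) =
      tensorPart x₁ (ψ s).1 (fun s' => naturalAction ψ s' w) +
        TensorAlgebra.ι K ((ψ s).2 x₁) * w := by
  have h := lift_step_snd ψ w (0, 1)
  simp only [mul_one] at h
  have h' := congrArg
    (fun y => TensorAlgebra.ι K ((ψ s).2 x₁) * y) h
  simp only [naturalAction_apply, map_mul, Module.End.mul_apply, TensorAlgebra.lift_ι_apply]
  exact congrArg₂ (· + ·) rfl h'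

end Recursion

section Restricted

attribute [local instance 100] LieRing.ofAssociativeRing

variable {K A : Type*} [CommRing K] [Ring A] [Algebra K A]

/-- The restricted Lie subalgebra generated by a subset `s` of an associative algebra `A` of
characteristic `p`: the least Lie subalgebra of `A` (for the commutator bracket) that
contains `s` and is closed under the `p`-mapping `a ↦ a ^ p` of `A`. -/
def restrictedClosure (K : Type*) {A : Type*} [CommRing K] [Ring A] [Algebra K A]
    (p : ℕ) (s : Set A) : LieSubalgebra K A :=
  sInf {L : LieSubalgebra K A | s ⊆ L ∧ ∀ a ∈ L, a ^ p ∈ L}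

theorem subset_restrictedClosure (p : ℕ) (s : Set A) :
    s ⊆ (restrictedClosure K p s : Set A) := by
  intro a ha
  simp only [restrictedClosure, LieSubalgebra.coe_sInf, Set.mem_iInter]
  exact fun L hL => hL.1 ha

theorem pow_mem_restrictedClosure (p : ℕ) (s : Set A) {a : A}
    (ha : a ∈ restrictedClosure K p s) : a ^ p ∈ restrictedClosure K p s := by
  rw [← SetLike.mem_coe] at ha ⊢
  simp only [restrictedClosure, LieSubalgebra.coe_sInf, Set.mem_iInter] at ha ⊢
  exact fun L hL => hL.2 a (ha L hL)

/-- The `p`-mapping of the restricted Lie algebra `restrictedClosure K p s`. -/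
def pMap (K : Type*) {A : Type*} [CommRing K] [Ring A] [Algebra K A] (p : ℕ) (s : Set A)
    (u : restrictedClosure K p s) : restrictedClosure K p s :=
  ⟨(u : A) ^ p, pow_mem_restrictedClosure p s u.2⟩

/-- The restricted self-similar Lie algebra defined by the recursion `ψ` over a ring `K` of
characteristic `p`: the image of the free restricted Lie algebra on `S` under its natural
action on `T(X)`, that is, the restricted Lie algebra of endomorphisms of `T(X)` generated by
the natural actions of the elements of `S`. -/
abbrev restrictedSelfSimilar {K X S : Type*} [CommRing K] [CommRing X] [Algebra K X]
    (p : ℕ) (ψ : WreathRecursion K X S) :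
    LieSubalgebra K (Module.End K (TensorAlgebra K X)) :=
  restrictedClosure K p (Set.range (naturalAction ψ))

end Restricted

section Grigorchuk

attribute [local instance 100] LieRing.ofAssociativeRing

/-- The alphabet `𝔽₂[x]/(x²)`, with `x = DualNumber.eps`. -/
abbrev Alphabet : Type := DualNumber (ZMod 2)

/-- The standard derivation `d/dx` of `𝔽₂[x]/(x²)`, sending `α + β x` to `β`. -/
def partialX : Derivation (ZMod 2) Alphabet Alphabet where
  toFun u := TrivSqZeroExt.inl u.snd
  map_add' u v := by simp
  map_smul' k u := by ext <;> simp
  map_one_eq_zero' := by simp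
  leibniz' u v := by
    ext
    · simp [mul_comm]
    · simp [mul_comm, CharTwo.add_self_eq_zero]

/-- The four generators. -/
inductive Gen : Type
  | a
  | b
  | c
  | d

/-- The recursion `a ↦ ∂ₓ`, `b ↦ x ⊗ (a + c)`, `c ↦ x ⊗ (a + d)`, `d ↦ x ⊗ b`. -/
def grigorchukRecursion : WreathRecursion (ZMod 2) Alphabet Gen
  | .a => (0, partialX)
  | .b => (DualNumber.eps ⊗ₜ (Finsupp.single .a 1 + Finsupp.single .c 1), 0)
  | .c => (DualNumber.eps ⊗ₜ (Finsupp.single .a 1 + Finsupp.single .d 1), 0)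
  | .d => (DualNumber.eps ⊗ₜ Finsupp.single .b 1, 0)

/-- The restricted Grigorchuk Lie algebra over `𝔽₂`. -/
abbrev GrigorchukLie : LieSubalgebra (ZMod 2)
    (Module.End (ZMod 2) (TensorAlgebra (ZMod 2) Alphabet)) :=
  restrictedSelfSimilar 2 grigorchukRecursion

/-- The `2`-mapping `u ↦ u²` of the restricted Grigorchuk Lie algebra. -/
abbrev sqMap : GrigorchukLie → GrigorchukLie :=
  pMap (ZMod 2) 2 (Set.range (naturalAction grigorchukRecursion))

end Grigorchuk

end

end SelfSimilarLie

namespace SelfSimilarLie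

section GrigorchukProof

attribute [local instance 100] LieRing.ofAssociativeRing

/-! Every operator involved is α∂ₓ + 1 ⊗ p + x ⊗ q, and products are computed in these coordinates
from x² = 0, ∂ₓ² = 0 and [∂ₓ, x] = 1. Nility: 1 ⊗ p doubles the degree of p, and x ⊗ q sends degree
e to 2e - 1. An element is thus a linear part in the generators plus a part of degrees 2 to D. If ∂ₓ
is absent, nilpotency passes to p, of degree about D/2. If it is present, the 1-slot of the square
is p² + q, still of degree at most D, and its linear part loses `genA` after at most three such
squarings; so induction on D works (`isNilpotent_lin_add`). Unbounded nillity: the algebra contains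
a set `Branch` stable under 1 ⊗ · and x ⊗ ·. If u = a + c + x ⊗ x ⊗ 1 ⊗ z, then u⁴ contains z three
levels down, so nillity grows with each nesting (`exists_bracket_pow_ne_zero`). Noncommutation of
powers is carried along rather than mere nonvanishing, since it gives both the 2-mapping and the
adjoint statements; nonnilpotency follows. -/

/-- The tensor algebra of the alphabet. -/
abbrev Words : Type := TensorAlgebra (ZMod 2) Alphabet

/-- The linear endomorphisms of the tensor algebra of the alphabet. -/
abbrev Operator : Type := Module.End (ZMod 2) Words

/-! ### Letters and coordinates of operators -/

/-- The letter `1`. -/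
noncomputable def letterOne : Words := TensorAlgebra.ι (ZMod 2) (1 : Alphabet)

/-- The letter `x`. -/
noncomputable def letterX : Words := TensorAlgebra.ι (ZMod 2) (DualNumber.eps : Alphabet)

/-- `Decomposes u α p q` says that `u` is `α ∂ₓ + 1 ⊗ p + x ⊗ q`. -/
def Decomposes (u : Operator) (α : ZMod 2) (p q : Operator) : Prop :=
  u 1 = 0 ∧ (∀ w, u (letterOne * w) = letterOne * p w + letterX * q w) ∧
    ∀ w, u (letterX * w) = α • (letterOne * w) + letterX * p w

theorem operator_add_self (u : Operator) : u + u = 0 := by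
  rw [← two_smul (ZMod 2) u, show (2 : ZMod 2) = 0 from rfl, zero_smul]

theorem operator_sub_eq_add (u v : Operator) : u - v = u + v := by
  rw [sub_eq_iff_eq_add, add_assoc, operator_add_self, add_zero]

theorem lie_eq_add (u v : Operator) : ⁅u, v⁆ = u * v + v * u := by
  rw [LieRing.of_associative_ring_bracket, operator_sub_eq_add]

theorem ι_eq (y : Alphabet) :
    TensorAlgebra.ι (ZMod 2) y = y.fst • letterOne + y.snd • letterX := by
  rw [letterOne, letterX, ← map_smul, ← map_smul, ← map_add]
  congr 1
  ext <;> simp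

theorem words_induction {P : Words → Prop} (one : P 1) (add : ∀ v w, P v → P w → P (v + w))
    (smul : ∀ (k : ZMod 2) w, P w → P (k • w)) (letterOne_mul : ∀ w, P w → P (letterOne * w))
    (letterX_mul : ∀ w, P w → P (letterX * w)) (w : Words) : P w := by
  suffices h : ∀ t, P t → P (w * t) by simpa using h 1 one
  induction w using TensorAlgebra.induction with
  | algebraMap r => intro t ht; rw [← Algebra.smul_def]; exact smul r t ht
  | ι y =>
    intro t ht
    rw [ι_eq, add_mul, smul_mul_assoc, smul_mul_assoc]
    exact add _ _ (smul _ _ (letterOne_mul t ht)) (smul _ _ (letterX_mul t ht))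
  | mul a b ha hb => intro t ht; rw [mul_assoc]; exact ha _ (hb t ht)
  | add a b ha hb => intro t ht; rw [add_mul]; exact add _ _ (ha t ht) (hb t ht)

theorem letterOne_ne_zero : letterOne ≠ 0 := by
  intro h
  exact one_ne_zero ((TensorAlgebra.ι_inj (ZMod 2) (1 : Alphabet) 0).1 (by rw [map_zero]; exact h))

theorem letterX_ne_zero : letterX ≠ 0 := by
  intro h
  have h0 : (DualNumber.eps : Alphabet) = 0 :=
    (TensorAlgebra.ι_inj (ZMod 2) _ _).1 (by rw [map_zero]; exact h)
  simpa using congrArg TrivSqZeroExt.snd h0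

namespace Decomposes

variable {u u' p p' q q' : Operator} {α α' : ZMod 2}

theorem unique (h : Decomposes u α p q) (h' : Decomposes u' α p q) : u = u' := by
  ext w
  induction w using words_induction with
  | one => rw [h.1, h'.1]
  | add v w hv hw => rw [map_add, map_add, hv, hw]
  | smul k w hw => rw [map_smul, map_smul, hw]
  | letterOne_mul w => rw [h.2.1, h'.2.1]
  | letterX_mul w => rw [h.2.2, h'.2.2]

protected theorem zero : Decomposes 0 0 0 0 := by
  simp [Decomposes]

theorem eq_zero (h : Decomposes u 0 0 0) : u = 0 := h.unique .zero

theorem components_eq_zero (h : Decomposes 0 0 p q) : p = 0 ∧ q = 0 := by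
  have hp : p = 0 := by
    ext w
    have := h.2.2 w
    simpa [letterX_ne_zero] using this.symm
  refine ⟨hp, ?_⟩
  ext w
  have := h.2.1 w
  simpa [hp, letterX_ne_zero] using this.symm

protected theorem add (h : Decomposes u α p q) (h' : Decomposes u' α' p' q') :
    Decomposes (u + u') (α + α') (p + p') (q + q') := by
  refine ⟨by simp [h.1, h'.1], fun w => ?_, fun w => ?_⟩
  · simp only [LinearMap.add_apply, h.2.1, h'.2.1, mul_add]; abel
  · simp only [LinearMap.add_apply, h.2.2, h'.2.2, mul_add, add_smul]; abel

protected theorem smul (k : ZMod 2) (h : Decomposes u α p q) :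
    Decomposes (k • u) (k * α) (k • p) (k • q) := by
  refine ⟨by simp [h.1], fun w => ?_, fun w => ?_⟩
  · simp only [LinearMap.smul_apply, h.2.1, mul_smul_comm, smul_add]
  · simp only [LinearMap.smul_apply, h.2.2, mul_smul_comm, smul_add, mul_smul]

protected theorem mul (h : Decomposes u 0 p q) (h' : Decomposes u' 0 p' q') :
    Decomposes (u * u') 0 (p * p') (p * q' + q * p') := by
  refine ⟨by simp [h'.1], fun w => ?_, fun w => ?_⟩
  · simp only [Module.End.mul_apply, LinearMap.add_apply, h.2.1, h'.2.1, h.2.2, map_add, mul_add,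
      zero_smul]
    abel
  · simp only [Module.End.mul_apply, h'.2.2, h.2.2, zero_smul, zero_add]

/-- The relation [∂ₓ, x] = 1 moves q from the x-slot to the 1-slot; the other terms containing ∂ₓ
cancel in characteristic 2. -/
theorem mul_self (h : Decomposes u α p q) :
    Decomposes (u * u) 0 (p * p + α • q) (p * q + q * p) := by
  refine ⟨by simp [h.1], fun w => ?_, fun w => ?_⟩
  · simp only [Module.End.mul_apply, LinearMap.add_apply, LinearMap.smul_apply, h.2.1, h.2.2,
      map_add, mul_add, mul_smul_comm]
    abel
  · simp only [Module.End.mul_apply, LinearMap.add_apply, LinearMap.smul_apply, h.2.1, h.2.2,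
      map_add, map_smul, mul_add, mul_smul_comm]
    clear h
    match_scalars <;> revert α <;> decide

theorem bracket (h : Decomposes u α p q) (h' : Decomposes u' α' p' q') :
    Decomposes (u * u' + u' * u) 0 (p * p' + p' * p + (α • q' + α' • q))
      ((p * q' + q' * p) + (q * p' + p' * q)) := by
  refine ⟨by simp [h.1, h'.1], fun w => ?_, fun w => ?_⟩
  · simp only [Module.End.mul_apply, LinearMap.add_apply, LinearMap.smul_apply, h.2.1, h.2.2,
      h'.2.1, h'.2.2, map_add, mul_add, mul_smul_comm]
    abel
  · simp only [Module.End.mul_apply, LinearMap.add_apply, LinearMap.smul_apply, h.2.1, h.2.2,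
      h'.2.1, h'.2.2, map_add, map_smul, mul_add, mul_smul_comm]
    clear h h'
    match_scalars <;> revert α α' <;> decide

theorem pow (h : Decomposes u 0 p q) {m : ℕ} (hm : m ≠ 0) :
    ∃ r, Decomposes (u ^ m) 0 (p ^ m) r := by
  induction m with
  | zero => exact absurd rfl hm
  | succ m ih =>
    rcases eq_or_ne m 0 with rfl | hm'
    · exact ⟨q, by simpa using h⟩
    · obtain ⟨r, hr⟩ := ih hm'
      exact ⟨_, by simpa only [pow_succ] using hr.mul h⟩

theorem pow_of_right_eq_zero (h : Decomposes u 0 p 0) {m : ℕ} (hm : m ≠ 0) :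
    Decomposes (u ^ m) 0 (p ^ m) 0 := by
  induction m with
  | zero => exact absurd rfl hm
  | succ m ih =>
    rcases eq_or_ne m 0 with rfl | hm'
    · simpa using h
    · simpa [pow_succ] using (ih hm').mul h

/-- A high power has 1-slot zero, so it is x ⊗ r, which squares to zero because x² = 0. -/
theorem isNilpotent (h : Decomposes u 0 p q) (hp : IsNilpotent p) : IsNilpotent u := by
  obtain ⟨n, hn⟩ := hp
  obtain ⟨r, hr⟩ := h.pow n.succ_ne_zero
  rw [pow_succ p, hn, zero_mul] at hr
  refine ⟨(n + 1) * 2, ?_⟩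
  rw [pow_mul, sq]
  exact eq_zero (by simpa using hr.mul hr)

end Decomposes

/-! ### The generators and their span -/

/-- The generator `a`. -/
noncomputable def genA : Operator := naturalAction grigorchukRecursion .a

/-- The generator `b`. -/
noncomputable def genB : Operator := naturalAction grigorchukRecursion .b

/-- The generator `c`. -/
noncomputable def genC : Operator := naturalAction grigorchukRecursion .c

/-- The generator `d`. -/
noncomputable def genD : Operator := naturalAction grigorchukRecursion .d

theorem partialX_eps : partialX (DualNumber.eps : Alphabet) = 1 := by
  change TrivSqZeroExt.inl (TrivSqZeroExt.snd DualNumber.eps) = _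
  simp

theorem decomposes_genA : Decomposes genA 1 0 0 := by
  refine ⟨naturalAction_one _ _, fun w => ?_, fun w => ?_⟩ <;>
  simp [genA, letterOne, letterX, naturalAction_ι_mul, grigorchukRecursion, tensorPart,
    partialX_eps]

theorem decomposes_genB : Decomposes genB 0 0 (genA + genC) := by
  refine ⟨naturalAction_one _ _, fun w => ?_, fun w => ?_⟩ <;>
  simp [genA, genB, genC, letterOne, letterX, naturalAction_ι_mul, grigorchukRecursion, tensorPart]

theorem decomposes_genC : Decomposes genC 0 0 (genA + genD) := by
  refine ⟨naturalAction_one _ _, fun w => ?_, fun w => ?_⟩ <;>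
  simp [genA, genD, genC, letterOne, letterX, naturalAction_ι_mul, grigorchukRecursion, tensorPart]

theorem decomposes_genD : Decomposes genD 0 0 genB := by
  refine ⟨naturalAction_one _ _, fun w => ?_, fun w => ?_⟩ <;>
  simp [genD, genB, letterOne, letterX, naturalAction_ι_mul, grigorchukRecursion, tensorPart]

/-- The sum s = b + c + d satisfies s = x ⊗ s, and such a fixed point kills every word by induction
on length. -/
theorem genD_eq : genD = genB + genC := by
  have h : Decomposes (genB + genC + genD) 0 0 (genB + genC + genD) := by
    have h0 := (decomposes_genB.add decomposes_genC).add decomposes_genD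
    have h1 : genA + genC + (genA + genD) + genB = genB + genC + genD := by
      rw [show genA + genC + (genA + genD) + genB = (genA + genA) + (genB + genC + genD) by abel,
        operator_add_self, zero_add]
    simpa [h1] using h0
  have h2 : genB + genC + genD = 0 := by
    ext w
    induction w using words_induction with
    | one => exact h.1
    | add v w hv hw => rw [map_add, map_add, hv, hw]
    | smul k w hw => rw [map_smul, map_smul, hw]
    | letterOne_mul w hw => rw [h.2.1, hw]; simp
    | letterX_mul w => rw [h.2.2]; simp
  rw [← sub_eq_zero, operator_sub_eq_add, add_comm, h2]

/-- The general element of the span of the generators. -/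
noncomputable def lin (α β γ : ZMod 2) : Operator := α • genA + β • genB + γ • genC

theorem lin_add (α β γ α' β' γ' : ZMod 2) :
    lin α β γ + lin α' β' γ' = lin (α + α') (β + β') (γ + γ') := by
  simp only [lin]; module

theorem smul_lin (k α β γ : ZMod 2) : k • lin α β γ = lin (k * α) (k * β) (k * γ) := by
  simp only [lin]; module

theorem lin_zero : lin 0 0 0 = 0 := by simp [lin]

theorem decomposes_lin (α β γ : ZMod 2) :
    Decomposes (lin α β γ) α 0 (lin (β + γ) γ (β + γ)) := by
  have h := ((decomposes_genA.smul α).add (decomposes_genB.smul β)).add (decomposes_genC.smul γ)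
  have e : lin (β + γ) γ (β + γ) =
      α • (0 : Operator) + β • (genA + genC) + γ • (genA + genD) := by
    rw [lin, genD_eq]; module
  rw [e]
  simpa [lin] using h

/-! ### The degree filtration -/

/-- `Higher D u` says that `u` is a sum of homogeneous components of degrees `2, …, D`, for the
grading in which the generators have degree `1` and `x` has degree `-1`. -/
inductive Higher : ℕ → Operator → Prop
  | zero (D : ℕ) : Higher D 0
  | node {D : ℕ} {α β γ : ZMod 2} {p q u : Operator} (hD : 2 ≤ D) (hp : Higher (D / 2) p)
      (hq : Higher ((D + 1) / 2) q) (hu : Decomposes u 0 (lin α β γ + p) q) : Higher D u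

namespace Higher

variable {D E : ℕ} {u v : Operator}

theorem mono (h : Higher D u) (hE : D ≤ E) : Higher E u := by
  induction h generalizing E with
  | zero D => exact zero E
  | node hD _ _ hu ihp ihq => exact node (by omega) (ihp (by omega)) (ihq (by omega)) hu

theorem exists_decomposes (h : Higher D u) : ∃ (α β γ : ZMod 2) (p q : Operator),
    Higher (D / 2) p ∧ Higher ((D + 1) / 2) q ∧ Decomposes u 0 (lin α β γ + p) q := by
  cases h with
  | zero => exact ⟨0, 0, 0, 0, 0, zero _, zero _, by simpa [lin_zero] using Decomposes.zero⟩
  | node hD hp hq hu => exact ⟨_, _, _, _, _, hp, hq, hu⟩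

protected theorem add (h : Higher D u) (h' : Higher D v) : Higher D (u + v) := by
  induction h generalizing v with
  | zero D => simpa using h'
  | @node D α β γ p q u hD _ _ hu ihp ihq =>
    obtain ⟨α', β', γ', p', q', hp', hq', hv⟩ := h'.exists_decomposes
    refine node hD (ihp hp') (ihq hq') (α := α + α') (β := β + β') (γ := γ + γ') ?_
    rw [← lin_add, add_add_add_comm]
    simpa using hu.add hv

protected theorem smul (k : ZMod 2) (h : Higher D u) : Higher D (k • u) := by
  have hk : ∀ k : ZMod 2, k = 0 ∨ k = 1 := by decide
  rcases hk k with rfl | rfl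
  · simpa using zero D
  · simpa using h

theorem node_zero (hD : 2 ≤ D) {p q : Operator} (hp : Higher (D / 2) p)
    (hq : Higher ((D + 1) / 2) q) (hu : Decomposes u 0 p q) : Higher D u :=
  node hD hp hq (α := 0) (β := 0) (γ := 0) (by simpa [lin_zero] using hu)

theorem node_lin (hD : 2 ≤ D) {α β γ : ZMod 2} (hu : Decomposes u 0 (lin α β γ) 0) : Higher D u :=
  node hD (zero _) (zero _) (α := α) (β := β) (γ := γ) (by rwa [add_zero])

/-- Linear elements have 1-slot zero, so only ∂ₓ acting on x contributes, which leaves 1 ⊗ (linear).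
-/
theorem lin_bracket_lin (α β γ α' β' γ' : ZMod 2) :
    Higher 2 (lin α β γ * lin α' β' γ' + lin α' β' γ' * lin α β γ) := by
  have h := (decomposes_lin α β γ).bracket (decomposes_lin α' β' γ')
  rw [smul_lin, smul_lin, lin_add] at h
  simp only [mul_zero, zero_mul, add_zero, zero_add] at h
  exact node_lin le_rfl h

theorem lin_mul_lin (α β γ : ZMod 2) : Higher 2 (lin α β γ * lin α β γ) := by
  have h := (decomposes_lin α β γ).mul_self
  rw [smul_lin] at h
  simp only [mul_zero, zero_mul, add_zero, zero_add] at h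
  exact node_lin le_rfl h

theorem lin_bracket (h : Higher D u) (α β γ : ZMod 2) :
    Higher (D + 1) (lin α β γ * u + u * lin α β γ) := by
  induction h generalizing α β γ with
  | zero D => simpa using zero _
  | @node D α' β' γ' p q u hD hp hq hu ihp ihq =>
    refine node_zero (by omega) ?_ ?_ ((decomposes_lin α β γ).bracket hu)
    · simpa using hq.smul α
    · have h1 := (lin_bracket_lin (β + γ) γ (β + γ) α' β' γ').mono
        (show 2 ≤ (D + 1 + 1) / 2 by omega)
      have h2 := (ihp (β + γ) γ (β + γ)).mono (show _ ≤ (D + 1 + 1) / 2 by omega)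
      convert h1.add h2 using 1
      noncomm_ring

theorem bracket (h : Higher D u) (h' : Higher E v) : Higher (D + E) (u * v + v * u) := by
  induction h generalizing E v with
  | zero D => simpa using zero _
  | @node D α β γ p q u hD hp hq hu ihp ihq =>
    cases h' with
    | zero => simpa using zero _
    | @node _ α' β' γ' p' q' _ hE hp' hq' hv =>
      refine node_zero (by omega) ?_ ?_ (hu.bracket hv)
      -- Both degree bounds are at least 2, which leaves room for the bracket of the linear parts.
      · have h1 := (lin_bracket_lin α β γ α' β' γ').mono (show _ ≤ (D + E) / 2 by omega)
        have h2 := (hp'.lin_bracket α β γ).mono (show _ ≤ (D + E) / 2 by omega)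
        have h3 := (hp.lin_bracket α' β' γ').mono (show _ ≤ (D + E) / 2 by omega)
        have h4 := (ihp hp').mono (show _ ≤ (D + E) / 2 by omega)
        convert ((h1.add h2).add h3).add h4 using 1
        rw [zero_smul, zero_smul]
        noncomm_ring
      · have h1 := (hq'.lin_bracket α β γ).mono (show _ ≤ (D + E + 1) / 2 by omega)
        have h2 := (hq.lin_bracket α' β' γ').mono (show _ ≤ (D + E + 1) / 2 by omega)
        have h3 := (ihp hq').mono (show _ ≤ (D + E + 1) / 2 by omega)
        have h4 := (ihq hp').mono (show _ ≤ (D + E + 1) / 2 by omega)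
        convert ((h1.add h2).add h3).add h4 using 1
        noncomm_ring

/-- The bound on p² is a hypothesis so that this serves inside the induction for `mul_self` as well
as after it. -/
theorem lin_add_mul_self {p : Operator} (h : Higher (D / 2) p) (hs : Higher (2 * (D / 2)) (p * p))
    (hD : 2 ≤ D) (α β γ : ZMod 2) : Higher D ((lin α β γ + p) * (lin α β γ + p)) := by
  have h1 := (lin_mul_lin α β γ).mono hD
  have h2 := (h.lin_bracket α β γ).mono (show _ ≤ D by omega)
  have h3 := hs.mono (show _ ≤ D by omega)
  convert (h1.add h2).add h3 using 1
  noncomm_ring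

theorem mul_self (h : Higher D u) : Higher (2 * D) (u * u) := by
  induction h with
  | zero D => simpa using zero _
  | @node D α β γ p q u hD hp hq hu ihp ihq =>
    refine node_zero (by omega) ?_ ?_ hu.mul_self
    · rw [zero_smul, add_zero]
      exact (lin_add_mul_self hp ihp hD α β γ).mono (by omega)
    · have h1 := (hq.lin_bracket α β γ).mono (show _ ≤ (2 * D + 1) / 2 by omega)
      have h2 := (hp.bracket hq).mono (show _ ≤ (2 * D + 1) / 2 by omega)
      convert h1.add h2 using 1
      noncomm_ring

theorem eq_zero_of_lt_two (h : Higher D u) (hD : D < 2) : u = 0 := by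
  cases h with
  | zero => rfl
  | node hD' => omega

end Higher

/-! ### Nility -/

theorem isNilpotent_lin_add (D : ℕ) : ∀ {f : Operator}, Higher D f → ∀ α β γ : ZMod 2,
    IsNilpotent (lin α β γ + f) := by
  induction D using Nat.strong_induction_on with
  | _ D ih =>
    -- Without ∂ₓ the 1-slot decides, and its degree bound is halved.
    have base {f : Operator} (hf : Higher D f) (β γ : ZMod 2) : IsNilpotent (lin 0 β γ + f) := by
      obtain ⟨α', β', γ', p, q, hp, hq, hd⟩ := hf.exists_decomposes
      rcases lt_or_ge D 2 with hD | hD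
      · rw [hf.eq_zero_of_lt_two hD, add_zero]
        exact (decomposes_lin 0 β γ).isNilpotent IsNilpotent.zero
      · refine ((decomposes_lin 0 β γ).add hd).isNilpotent ?_
        rw [zero_add]
        exact ih _ (by omega) hp _ _ _
    -- With ∂ₓ, squaring keeps the bound D and changes the linear part from (1, β, γ) to (β + γ, γ,
    -- β + γ).
    have step {f : Operator} (hf : Higher D f) (β γ : ZMod 2)
        (h : ∀ {g : Operator}, Higher D g → IsNilpotent (lin (β + γ) γ (β + γ) + g)) :
        IsNilpotent (lin 1 β γ + f) := by
      have key : ∃ P Q, Decomposes (lin 1 β γ + f) 1 P (lin (β + γ) γ (β + γ) + Q) ∧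
          Higher D (P * P + Q) := by
        obtain ⟨α', β', γ', p, q, hp, hq, hd⟩ := hf.exists_decomposes
        rcases lt_or_ge D 2 with hD | hD
        · rw [hf.eq_zero_of_lt_two hD]
          exact ⟨0, 0, by simpa using decomposes_lin 1 β γ, by simpa using Higher.zero D⟩
        · exact ⟨_, _, by simpa using (decomposes_lin 1 β γ).add hd,
            (Higher.lin_add_mul_self hp hp.mul_self hD _ _ _).add (hq.mono (by omega))⟩
      obtain ⟨P, Q, hd, hPQ⟩ := key
      have hs := hd.mul_self.isNilpotent (by
        convert h hPQ using 1
        rw [one_smul]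
        abel)
      obtain ⟨n, hn⟩ := hs
      exact ⟨2 * n, by rw [pow_mul, sq, hn]⟩
    intro f hf α β γ
    have h01 : ∀ k : ZMod 2, k = 0 ∨ k = 1 := by decide
    have h11 : (1 : ZMod 2) + 1 = 0 := rfl
    rcases h01 α with rfl | rfl
    · exact base hf β γ
    -- The squaring rule gives (1,1,0) → (1,0,1) → (1,1,1) → (0,1,0) and (1,0,0) → (0,0,0), so it
    -- always ends without ∂ₓ.
    have hd {f : Operator} (hf : Higher D f) : IsNilpotent (lin 1 1 1 + f) :=
      step hf 1 1 fun hg => by rw [h11]; exact base hg _ _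
    have hc {f : Operator} (hf : Higher D f) : IsNilpotent (lin 1 0 1 + f) :=
      step hf 0 1 fun hg => by rw [zero_add]; exact hd hg
    rcases h01 β with rfl | rfl <;> rcases h01 γ with rfl | rfl
    · exact step hf 0 0 fun hg => by rw [zero_add]; exact base hg _ _
    · exact hc hf
    · exact step hf 1 0 fun hg => by rw [add_zero]; exact hc hg
    · exact hd hf

/-- A restricted Lie algebra of nil operators that contains the Grigorchuk Lie algebra. -/
def boundedDegree : LieSubalgebra (ZMod 2) Operator where
  carrier := {u | ∃ (D : ℕ) (α β γ : ZMod 2) (f : Operator), Higher D f ∧ u = lin α β γ + f}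
  add_mem' := by
    rintro _ _ ⟨D, α, β, γ, f, hf, rfl⟩ ⟨E, α', β', γ', g, hg, rfl⟩
    exact ⟨max D E, α + α', β + β', γ + γ', _,
      (hf.mono (le_max_left D E)).add (hg.mono (le_max_right D E)),
      by rw [← lin_add, add_add_add_comm]⟩
  zero_mem' := ⟨0, 0, 0, 0, 0, .zero 0, by simp [lin_zero]⟩
  smul_mem' := by
    rintro k _ ⟨D, α, β, γ, f, hf, rfl⟩
    exact ⟨D, k * α, k * β, k * γ, _, hf.smul k, by rw [smul_add, smul_lin]⟩
  lie_mem' := by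
    rintro _ _ ⟨D, α, β, γ, f, hf, rfl⟩ ⟨E, α', β', γ', g, hg, rfl⟩
    have h1 := (Higher.lin_bracket_lin α β γ α' β' γ').mono (show _ ≤ D + E + 2 by omega)
    have h2 := (hg.lin_bracket α β γ).mono (show _ ≤ D + E + 2 by omega)
    have h3 := (hf.lin_bracket α' β' γ').mono (show _ ≤ D + E + 2 by omega)
    have h4 := (hf.bracket hg).mono (show _ ≤ D + E + 2 by omega)
    refine ⟨D + E + 2, 0, 0, 0, _, ((h1.add h2).add h3).add h4, ?_⟩
    rw [lie_eq_add, lin_zero]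
    noncomm_ring

theorem mul_self_mem_boundedDegree {u : Operator} (hu : u ∈ boundedDegree) :
    u * u ∈ boundedDegree := by
  obtain ⟨D, α, β, γ, f, hf, rfl⟩ := hu
  have h1 := (Higher.lin_mul_lin α β γ).mono (show _ ≤ 2 * D + 2 by omega)
  have h2 := (hf.lin_bracket α β γ).mono (show _ ≤ 2 * D + 2 by omega)
  have h3 := hf.mul_self.mono (show _ ≤ 2 * D + 2 by omega)
  refine ⟨2 * D + 2, 0, 0, 0, _, (h1.add h2).add h3, ?_⟩
  rw [lin_zero]
  noncomm_ring

theorem grigorchukLie_le_boundedDegree : GrigorchukLie ≤ boundedDegree := by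
  refine sInf_le ⟨?_, fun u hu => by rw [sq]; exact mul_self_mem_boundedDegree hu⟩
  rintro _ ⟨_ | _ | _ | _, rfl⟩
  · exact ⟨0, 1, 0, 0, 0, .zero 0, by simp [lin, genA]⟩
  · exact ⟨0, 0, 1, 0, 0, .zero 0, by simp [lin, genB]⟩
  · exact ⟨0, 0, 0, 1, 0, .zero 0, by simp [lin, genC]⟩
  · exact ⟨0, 0, 1, 1, 0, .zero 0, by simpa [lin, genD] using genD_eq⟩

theorem isNilpotent_of_mem_grigorchukLie {u : Operator} (hu : u ∈ GrigorchukLie) :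
    IsNilpotent u := by
  obtain ⟨D, α, β, γ, f, hf, rfl⟩ := grigorchukLie_le_boundedDegree hu
  exact isNilpotent_lin_add D hf α β γ

/-! ### Shifted elements and branching -/

/-- The pair `(1 ⊗ ⋯ ⊗ 1 ⊗ (a + c), 1 ⊗ ⋯ ⊗ 1 ⊗ b)` with `n` leading factors. -/
noncomputable def shifted : ℕ → Operator × Operator
  | 0 => (genA + genC, genB)
  | n + 1 => ((shifted n).1 * (shifted n).2 + (shifted n).2 * (shifted n).1,
      (shifted n).1 * (shifted n).1 +
        ((shifted n).1 * (shifted n).2 + (shifted n).2 * (shifted n).1))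

theorem decomposes_genA_add_genC : Decomposes (genA + genC) 1 0 (genA + genD) := by
  simpa using decomposes_genA.add decomposes_genC

theorem decomposes_genA_add_genD : Decomposes (genA + genD) 1 0 genB := by
  simpa using decomposes_genA.add decomposes_genD

theorem genA_add_genD : genA + genD = genA + genC + genB := by
  rw [genD_eq]; abel

/-- At the bottom, [a + c, b] = 1 ⊗ (a + c) and (a + c)² = 1 ⊗ (a + d), with (a + d) + (a + c) = b.
Higher up, 1 ⊗ · respects brackets and squares. -/
theorem decomposes_shifted (n : ℕ) :
    Decomposes (shifted (n + 1)).1 0 (shifted n).1 0 ∧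
      Decomposes (shifted (n + 1)).2 0 (shifted n).2 0 := by
  induction n with
  | zero =>
    have h1 := decomposes_genA_add_genC.bracket decomposes_genB
    have h2 := decomposes_genA_add_genC.mul_self.add h1
    have e : genA + genD + (genA + genC) = genB := by
      rw [genA_add_genD, add_right_comm, operator_add_self, zero_add]
    exact ⟨by simpa [shifted] using h1, by simpa [shifted, e] using h2⟩
  | succ n ih =>
    have h1 := ih.1.bracket ih.2
    have h2 := ih.1.mul_self.add h1
    exact ⟨by simpa [shifted] using h1, by simpa [shifted] using h2⟩

theorem gen_mem_grigorchukLie (s : Gen) : naturalAction grigorchukRecursion s ∈ GrigorchukLie :=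
  subset_restrictedClosure 2 _ ⟨s, rfl⟩

theorem bracket_mem_grigorchukLie {u v : Operator} (hu : u ∈ GrigorchukLie)
    (hv : v ∈ GrigorchukLie) : u * v + v * u ∈ GrigorchukLie := by
  rw [← lie_eq_add]
  exact GrigorchukLie.lie_mem hu hv

theorem genA_add_genC_mem : genA + genC ∈ GrigorchukLie :=
  add_mem (gen_mem_grigorchukLie .a) (gen_mem_grigorchukLie .c)

theorem shifted_mem (n : ℕ) :
    (shifted n).1 ∈ GrigorchukLie ∧ (shifted n).2 ∈ GrigorchukLie := by
  induction n with
  | zero => exact ⟨genA_add_genC_mem, gen_mem_grigorchukLie .b⟩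
  | succ n ih =>
    have h := bracket_mem_grigorchukLie ih.1 ih.2
    refine ⟨h, add_mem ?_ h⟩
    rw [← sq]
    exact pow_mem_restrictedClosure 2 _ ih.1

/-- A set of elements of the Grigorchuk Lie algebra over which it branches. -/
inductive Branch : Operator → Prop
  | base : Branch (shifted 1).1
  | add {y z : Operator} (hy : Branch y) (hz : Branch z) : Branch (y + z)
  | fst (n : ℕ) {z : Operator} (hz : Branch z) : Branch ((shifted n).1 * z + z * (shifted n).1)
  | snd (n : ℕ) {z : Operator} (hz : Branch z) : Branch ((shifted n).2 * z + z * (shifted n).2)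

theorem Branch.mem {z : Operator} (h : Branch z) : z ∈ GrigorchukLie := by
  induction h with
  | base => exact (shifted_mem 1).1
  | add _ _ ihy ihz => exact add_mem ihy ihz
  | fst n _ ih => exact bracket_mem_grigorchukLie (shifted_mem n).1 ih
  | snd n _ ih => exact bracket_mem_grigorchukLie (shifted_mem n).2 ih

theorem decomposes_shifted_bracket :
    Decomposes ((shifted 0).1 * (shifted 1).1 + (shifted 1).1 * (shifted 0).1) 0 0
      (shifted 1).1 := by
  have h := decomposes_genA_add_genC.bracket (decomposes_shifted 0).1
  have e : (genA + genD) * (genA + genC) + (genA + genC) * (genA + genD) = (shifted 1).1 := by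
    rw [genA_add_genD, show (shifted 1).1 = (genA + genC) * genB + genB * (genA + genC) from rfl]
    generalize genA + genC = g
    rw [show (g + genB) * g + g * (g + genB) = (g * g + g * g) + (g * genB + genB * g) by
      noncomm_ring, operator_add_self, zero_add]
  simpa [show (shifted 0).1 = genA + genC from rfl, e] using h

/-- For z = [a + c, b], bracketing z with 1 ⊗ b gives 1 ⊗ z, and with a + c gives x ⊗ z. Brackets
with shifted elements lift by shifting once more. -/
theorem Branch.exists_tensor {z : Operator} (h : Branch z) :
    (∃ y, Branch y ∧ Decomposes y 0 z 0) ∧ ∃ y, Branch y ∧ Decomposes y 0 0 z := by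
  induction h with
  | base =>
    refine ⟨⟨_, .snd 1 .base, ?_⟩, ⟨_, .fst 0 .base, decomposes_shifted_bracket⟩⟩
    rw [add_comm]
    exact (decomposes_shifted 1).1
  | add _ _ ih ih' =>
    obtain ⟨⟨y₀, hy₀, hd₀⟩, ⟨y₁, hy₁, hd₁⟩⟩ := ih
    obtain ⟨⟨z₀, hz₀, he₀⟩, ⟨z₁, hz₁, he₁⟩⟩ := ih'
    exact ⟨⟨_, hy₀.add hz₀, by simpa using hd₀.add he₀⟩, ⟨_, hy₁.add hz₁, by simpa using hd₁.add he₁⟩⟩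
  | fst n _ ih =>
    obtain ⟨⟨y, hy, hd⟩, ⟨y', hy', hd'⟩⟩ := ih
    exact ⟨⟨_, .fst (n + 1) hy, by simpa using (decomposes_shifted n).1.bracket hd⟩,
      ⟨_, .fst (n + 1) hy', by simpa using (decomposes_shifted n).1.bracket hd'⟩⟩
  | snd n _ ih =>
    obtain ⟨⟨y, hy, hd⟩, ⟨y', hy', hd'⟩⟩ := ih
    exact ⟨⟨_, .snd (n + 1) hy, by simpa using (decomposes_shifted n).2.bracket hd⟩,
      ⟨_, .snd (n + 1) hy', by simpa using (decomposes_shifted n).2.bracket hd'⟩⟩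

theorem genA_add_genC_ne_zero : genA + genC ≠ 0 := by
  intro h
  have h1 := decomposes_genA_add_genC.2.2 1
  rw [h] at h1
  simpa [letterOne_ne_zero] using h1.symm

theorem ne_zero_of_decomposes_left {u p q : Operator} (h : Decomposes u 0 p q) (hp : p ≠ 0) :
    u ≠ 0 := by
  rintro rfl
  exact hp h.components_eq_zero.1

theorem ne_zero_of_decomposes_right {u p q : Operator} (h : Decomposes u 0 p q) (hq : q ≠ 0) :
    u ≠ 0 := by
  rintro rfl
  exact hq h.components_eq_zero.2

/-! ### Unbounded nillity -/

/-- If `u = a + c + x ⊗ x ⊗ 1 ⊗ z`, then `u⁴ = 1 ⊗ 1 ⊗ (b + 1 ⊗ z)`. -/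
theorem decomposes_pow_four {z t t₁ t₂ : Operator} (ht : Decomposes t 0 0 t₁)
    (ht₁ : Decomposes t₁ 0 0 t₂) (ht₂ : Decomposes t₂ 0 z 0) {m : ℕ} (hm : m ≠ 0) :
    ∃ s₁ s₂ r, Decomposes ((genA + genC + t) ^ (4 * m)) 0 s₁ 0 ∧ Decomposes s₁ 0 s₂ 0 ∧
      Decomposes s₂ 0 (z ^ m) r := by
  have h1 := (decomposes_genA_add_genC.add ht).mul_self
  have h2 := (decomposes_genA_add_genD.add ht₁).mul_self
  obtain ⟨r, h3⟩ := (decomposes_genB.add ht₂).pow hm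
  simp only [add_zero, mul_zero, zero_mul, zero_add, one_smul] at h1 h2 h3
  refine ⟨_, _, r, ?_, h2.pow_of_right_eq_zero hm, h3⟩
  have h4 := h1.pow_of_right_eq_zero (mul_ne_zero two_ne_zero hm)
  rwa [← sq, ← pow_mul, ← mul_assoc, pow_mul (genA + genD + t₁) 2 m, sq (genA + genD + t₁)] at h4

/-- The clause that 1 ⊗ u lies in `Branch` is what lets u be nested into the next element. -/
theorem exists_bracket_pow_ne_zero (k : ℕ) : ∃ u ∈ GrigorchukLie, (∃ y, Branch y ∧
    Decomposes y 0 u 0) ∧ ∃ v, Branch v ∧ u ^ 4 ^ k * v + v * u ^ 4 ^ k ≠ 0 := by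
  induction k with
  | zero =>
    refine ⟨_, genA_add_genC_mem, ⟨_, .base, (decomposes_shifted 0).1⟩, _, .base, ?_⟩
    rw [pow_zero, pow_one]
    exact ne_zero_of_decomposes_right decomposes_shifted_bracket
      (ne_zero_of_decomposes_left (decomposes_shifted 0).1 genA_add_genC_ne_zero)
  | succ k ih =>
    obtain ⟨z, hz, ⟨t₂, ht₂, hd₂⟩, v, hv, hne⟩ := ih
    -- The next element is a + c + t with t = x ⊗ x ⊗ 1 ⊗ z, tested against 1 ⊗ 1 ⊗ x ⊗ v; 1 ⊗ t
    -- maintains the `Branch` clause.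
    obtain ⟨t₁, ht₁, hd₁⟩ := ht₂.exists_tensor.2
    obtain ⟨t, ht, hd⟩ := ht₁.exists_tensor.2
    obtain ⟨t', ht', hd'⟩ := ht.exists_tensor.1
    obtain ⟨v₁, hv₁, he₁⟩ := hv.exists_tensor.2
    obtain ⟨v₂, hv₂, he₂⟩ := hv₁.exists_tensor.1
    obtain ⟨v₃, hv₃, he₃⟩ := hv₂.exists_tensor.1
    obtain ⟨s₁, s₂, r, hs, hs₁, hs₂⟩ :=
      decomposes_pow_four hd hd₁ hd₂ (pow_ne_zero k four_ne_zero)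
    refine ⟨_, add_mem genA_add_genC_mem ht.mem, ⟨_, Branch.base.add ht',
      by simpa [show (shifted 0).1 = genA + genC from rfl] using (decomposes_shifted 0).1.add hd'⟩, v₃, hv₃, ?_⟩
    rw [pow_succ']
    refine ne_zero_of_decomposes_left (hs.bracket he₃) ?_
    simp only [zero_smul, add_zero]
    refine ne_zero_of_decomposes_left (hs₁.bracket he₂) ?_
    simp only [zero_smul, add_zero]
    -- The unknown x ⊗ r drops out against x ⊗ v, since x² = 0, and [z^(4^k), v] remains.
    refine ne_zero_of_decomposes_right (hs₂.bracket he₁) ?_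
    simpa using hne

/-! ### Transfer to the 2-mapping and the adjoint representation -/

theorem coe_sqMap_iterate (n : ℕ) (u : GrigorchukLie) :
    ((sqMap^[n] u : GrigorchukLie) : Operator) = (u : Operator) ^ 2 ^ n := by
  induction n with
  | zero => simp
  | succ n ih =>
    rw [Function.iterate_succ_apply', pow_succ, pow_mul, ← ih]
    rfl

/-- In characteristic 2 the cross terms of ad(x)² cancel, so ad(x)² = ad(x²). -/
theorem coe_ad_pow_two_pow {K A : Type*} [CommRing K] [Ring A] [Algebra K A]
    (hA : ∀ x : A, x + x = 0) (L : LieSubalgebra K A) (n : ℕ) (u v : L) :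
    (((LieAlgebra.ad K L u ^ 2 ^ n) v : L) : A) =
      (u : A) ^ 2 ^ n * v + v * (u : A) ^ 2 ^ n := by
  induction n generalizing v with
  | zero =>
    rw [pow_zero, pow_one, pow_one, LieAlgebra.ad_apply, LieSubalgebra.coe_bracket,
      LieRing.of_associative_ring_bracket, sub_eq_iff_eq_add, add_assoc, hA, add_zero]
  | succ n ih =>
    rw [pow_succ, mul_two, pow_add, Module.End.mul_apply, ih, ih, pow_add]
    generalize (u : A) ^ 2 ^ n = x
    generalize (v : A) = y
    rw [show x * (x * y + y * x) + (x * y + y * x) * x =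
      x * x * y + y * (x * x) + (x * y * x + x * y * x) by noncomm_ring, hA, add_zero]

theorem not_isNilpotent_of_ad_pow_ne_zero {K A : Type*} [CommRing K] [Ring A] [Algebra K A]
    (L : LieSubalgebra K A) (h : ∀ n : ℕ, ∃ u : L, LieAlgebra.ad K L u ^ n ≠ 0) :
    ¬ LieRing.IsNilpotent L := by
  intro hL
  obtain ⟨k, hk⟩ := LieAlgebra.nilpotent_ad_of_nilpotent_algebra K L
  obtain ⟨u, hu⟩ := h k
  exact hu (hk u)

theorem exists_pow_two_pow_eq_zero (u : GrigorchukLie) : ∃ n : ℕ, (u : Operator) ^ 2 ^ n = 0 := by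
  obtain ⟨n, hn⟩ := isNilpotent_of_mem_grigorchukLie u.2
  exact ⟨n, pow_eq_zero_of_le n.lt_two_pow_self.le hn⟩

/-- An element commuting with u^(2^n) commutes with its power u^(4^n). -/
theorem exists_bracket_pow_two_pow_ne_zero (n : ℕ) : ∃ u ∈ GrigorchukLie, ∃ v ∈ GrigorchukLie,
    u ^ 2 ^ n * v + v * u ^ 2 ^ n ≠ 0 := by
  obtain ⟨u, hu, -, v, hv, hne⟩ := exists_bracket_pow_ne_zero n
  refine ⟨u, hu, v, hv.mem, fun h => hne ?_⟩
  have h0 : v * u ^ 2 ^ n = u ^ 2 ^ n * v := by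
    rw [← sub_eq_zero, operator_sub_eq_add, add_comm, h]
  have h1 : Commute v (u ^ 4 ^ n) := by
    rw [show 4 ^ n = 2 ^ n * 2 ^ n by rw [← mul_pow]; norm_num, pow_mul]
    exact Commute.pow_right h0 _
  rw [h1.eq, operator_add_self]

theorem exists_ad_pow_ne_zero (n : ℕ) :
    ∃ u : GrigorchukLie, LieAlgebra.ad (ZMod 2) GrigorchukLie u ^ n ≠ 0 := by
  obtain ⟨u, hu, v, hv, hne⟩ := exists_bracket_pow_two_pow_ne_zero n
  refine ⟨⟨u, hu⟩, fun h => hne ?_⟩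
  have h1 := coe_ad_pow_two_pow operator_add_self GrigorchukLie n ⟨u, hu⟩ ⟨v, hv⟩
  rw [pow_eq_zero_of_le n.lt_two_pow_self.le h] at h1
  exact h1.symm

theorem exists_sqMap_iterate_ne_zero (n : ℕ) : ∃ u : GrigorchukLie, sqMap^[n] u ≠ 0 := by
  obtain ⟨u, hu, v, -, hne⟩ := exists_bracket_pow_two_pow_ne_zero n
  refine ⟨⟨u, hu⟩, fun h => hne ?_⟩
  have h0 : u ^ 2 ^ n = 0 := by
    rw [← coe_sqMap_iterate n ⟨u, hu⟩, h]
    rfl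
  rw [h0, zero_mul, mul_zero, add_zero]

theorem isNilpotent_ad_grigorchukLie (u : GrigorchukLie) :
    IsNilpotent (LieAlgebra.ad (ZMod 2) GrigorchukLie u) := by
  obtain ⟨n, hn⟩ := exists_pow_two_pow_eq_zero u
  refine ⟨2 ^ n, LinearMap.ext fun v => Subtype.ext ?_⟩
  refine (coe_ad_pow_two_pow operator_add_self GrigorchukLie n u v).trans ?_
  have h : (u : Operator) ^ 2 ^ n * v + v * (u : Operator) ^ 2 ^ n = 0 := by
    rw [hn, zero_mul, mul_zero, add_zero]
  exact h

theorem exists_sqMap_iterate_eq_zero (u : GrigorchukLie) : ∃ n : ℕ, sqMap^[n] u = 0 := by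
  obtain ⟨n, hn⟩ := exists_pow_two_pow_eq_zero u
  exact ⟨n, Subtype.ext ((coe_sqMap_iterate n u).trans hn)⟩

theorem not_isNilpotent_grigorchukLie : ¬ LieRing.IsNilpotent GrigorchukLie :=
  not_isNilpotent_of_ad_pow_ne_zero GrigorchukLie exists_ad_pow_ne_zero

end GrigorchukProof

end SelfSimilarLie

theorem mainTheorem3 :
    -- nil, for the `2`-mapping and for the adjoint representation
    ((∀ u : SelfSimilarLie.GrigorchukLie, ∃ n : ℕ, SelfSimilarLie.sqMap^[n] u = 0) ∧
      (∀ u : SelfSimilarLie.GrigorchukLie,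
        IsNilpotent (LieAlgebra.ad (ZMod 2) SelfSimilarLie.GrigorchukLie u))) ∧
    -- of unbounded nillity, in both senses
    ((∀ n : ℕ, ∃ u : SelfSimilarLie.GrigorchukLie, SelfSimilarLie.sqMap^[n] u ≠ 0) ∧
      (∀ n : ℕ, ∃ u : SelfSimilarLie.GrigorchukLie,
        LieAlgebra.ad (ZMod 2) SelfSimilarLie.GrigorchukLie u ^ n ≠ 0)) ∧
    -- not nilpotent
    ¬ LieRing.IsNilpotent SelfSimilarLie.GrigorchukLie := by
  exact ⟨⟨SelfSimilarLie.exists_sqMap_iterate_eq_zero, SelfSimilarLie.isNilpotent_ad_grigorchukLie⟩,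
    ⟨SelfSimilarLie.exists_sqMap_iterate_ne_zero, SelfSimilarLie.exists_ad_pow_ne_zero⟩,
    SelfSimilarLie.not_isNilpotent_grigorchukLie⟩
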